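/- Let $n\ge 1$. A permutation $\sigma=\sigma_1\cdots\sigma_n$ of $\{1,\dots,n\}$ has an alternating descent at position $i\in\{1,\dots,n-1\}$ if either $i$ is odd and $\sigma_i>\sigma_{i+1}$, or $i$ is even and $\sigma_i<\sigma_{i+1}$. Let $\hat d(\sigma)$ be the number of alternating descents of $\sigma$, and let $$\hat A_n(t)=\sum_{\sigma\in\mathfrak S_n}t^{\hat d(\sigma)+1}$$ be the alternating Eulerian polynomial. Let $E_k$ be the Euler number, that is, the number of permutations $\sigma\in\mathfrak S_k$ with $\sigma_1<\sigma_2>\sigma_3<\cdots$ (so $E_0=1$). For a partition $\lambda$ with $r_i$ parts equal to $i$, let $z_\lambda=1^{r_1}\,r_1!\,2^{r_2}\,r_2!\cdots$, and define $$\hat f_n(m)=\sum_{\lambda}\frac{n!}{z_\lambda}\cdot\frac{E_{\lambda_1-1}E_{\lambda_2-1}\cdots E_{\lambda_{\ell(\lambda)}-1}}{(\lambda_1-1)!\,(\lambda_2-1)!\cdots(\lambda_{\ell(\lambda)}-1)!}\cdot m^{\ell(\lambda)},$$ where the sum is over all partitions $\lambda=(\lambda_1,\dots,\lambda_{\ell(\lambda)})$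 of $n$ into odd parts. Then, as formal power series in $t$, $$\frac{\hat A_n(t)}{(1-t)^{n+1}}=\sum_{m\ge 1}\hat f_n(m)\,t^m.$$ -/

import Mathlib

open scoped Nat

namespace AltEulerian

/-- The entry `σ_i` (with `1 ≤ i ≤ n`) of the one-line word `σ_1 σ_2 ⋯ σ_n` of a permutation.
Values are compared only, so it does not matter that they are numbered from `0`. -/
def entry {n : ℕ} (σ : Equiv.Perm (Fin n)) (i : ℕ) (h1 : 1 ≤ i) (hn : i ≤ n) : Fin n :=
  σ ⟨i - 1, by omega⟩

/-- `σ` has an alternating descent at the position `i ∈ [n - 1]`: either `i` is odd and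
`σ_i > σ_{i+1}`, or `i` is even and `σ_i < σ_{i+1}`. -/
def IsAltDescent {n : ℕ} (σ : Equiv.Perm (Fin n)) (i : ℕ) : Prop :=
  ∃ (h1 : 1 ≤ i) (hn : i < n),
    (Odd i ∧ entry σ (i + 1) (by omega) (by omega) < entry σ i h1 (by omega)) ∨
    (Even i ∧ entry σ i h1 (by omega) < entry σ (i + 1) (by omega) (by omega))

instance {n : ℕ} (σ : Equiv.Perm (Fin n)) (i : ℕ) : Decidable (IsAltDescent σ i) := by
  unfold IsAltDescent; infer_instance

/-- The alternating descent set, a subset of `[n - 1] = {1, …, n - 1}`. -/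
def altDescentSet {n : ℕ} (σ : Equiv.Perm (Fin n)) : Finset ℕ :=
  (Finset.Ico 1 n).filter fun i => IsAltDescent σ i

/-- The number of alternating descents. -/
def altDes {n : ℕ} (σ : Equiv.Perm (Fin n)) : ℕ := (altDescentSet σ).card

/-- The alternating Eulerian polynomial `∑_σ t ^ (altDes σ + 1)`. -/
noncomputable def altEulerianPoly (n : ℕ) : Polynomial ℚ :=
  ∑ σ : Equiv.Perm (Fin n), Polynomial.X ^ (altDes σ + 1)

/-- `σ` is an up-down permutation: `σ_1 < σ_2 > σ_3 < ⋯`. -/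
def IsUpDown {n : ℕ} (σ : Equiv.Perm (Fin n)) : Prop :=
  ∀ (i : ℕ) (hn : i < n) (h1 : 1 ≤ i),
    (Odd i → entry σ i h1 (by omega) < entry σ (i + 1) (by omega) (by omega)) ∧
    (Even i → entry σ (i + 1) (by omega) (by omega) < entry σ i h1 (by omega))

instance {n : ℕ} (σ : Equiv.Perm (Fin n)) : Decidable (IsUpDown σ) := by
  unfold IsUpDown; infer_instance

/-- The Euler number `E_n`: the number of up-down permutations of `[n]` (so `E_0 = 1`). -/
def eulerNumber (n : ℕ) : ℕ :=
  (Finset.univ.filter fun σ : Equiv.Perm (Fin n) => IsUpDown σ).card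

/-- `z_λ = 1 ^ r_1 * r_1! * 2 ^ r_2 * r_2! * ⋯`, where `r_i` is the number of parts of `λ`
equal to `i`; the values `i` with `r_i = 0` contribute the factor `1` and are left out. -/
def zee {n : ℕ} (p : n.Partition) : ℕ :=
  ∏ i ∈ p.parts.toFinset, i ^ p.parts.count i * (p.parts.count i)!

/-- The polynomial
`∑_λ (n! / z_λ) * (∏_i E_{λ_i - 1} / (λ_i - 1)!) * m ^ ℓ(λ)` in the variable `m`,
where `λ` runs over the partitions of `n` into odd parts. -/
noncomputable def fHat (n : ℕ) : Polynomial ℚ :=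
  ∑ p ∈ Nat.Partition.odds n,
    Polynomial.C ((n ! : ℚ) / (zee p : ℚ) *
      (p.parts.map fun a => (eulerNumber (a - 1) : ℚ) / ((a - 1)! : ℚ)).prod) *
    Polynomial.X ^ p.parts.card

end AltEulerian

/-! Let E(x) be the exponential generating function of the Euler numbers. Both sides reduce to the
numbers n! [x^n] E(x)^m.

Cut the word of σ into m consecutive, possibly empty blocks free of alternating descents, parity
being counted in the whole word. The m - 1 bars go into n + 1 gaps, with at least one bar at each of
the d alternating descents, so the counts have generating function t^(d+1) / (1-t)^(n+1) in m
(`one_sub_X_pow_mul_mk_cuts`). For fixed m, summing over σ gives n! [x^n] E^m (`sum_cuts_eq`), since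
a block on k given letters can be filled in E_k ways, whichever direction it starts with
(`altCount_eq_eulerNumber`).

Removing the smallest letter gives E' = F E, where F is the even part of E. Hence E^m = exp(m ∫ F),
and the exponential formula expands this over partitions, with odd parts only because F is even.
Instead of an exponential, the proof compares recurrences: both sides satisfy n a_n = ∑ i b_i
a_(n-i), with ∑ b_i x^i = m ∫ F (`succ_mul_partitionSum_succ`, `derivative_eulerSeries`). -/

namespace AltEulerian

/-! ### Cutting a word into alternating blocks. -/

section Lists

variable {α : Type}

open Classical in
/-- The number of positions where a word fails to alternate: the first step should be an
`r`-step, the second one a `flip r`-step, and so on. -/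
noncomputable def altDefects : (α → α → Prop) → List α → ℕ
  | _, [] => 0
  | r, x :: l => (if ∀ y ∈ l.head?, r x y then 0 else 1) + altDefects (flip r) l

theorem altDefects_cons_eq_zero (r : α → α → Prop) (x : α) (l : List α) :
    altDefects r (x :: l) = 0 ↔ (∀ y ∈ l.head?, r x y) ∧ altDefects (flip r) l = 0 := by
  simp [altDefects]

/-- The step entering `a` can only be a `flip r`-step, so it must have even index, which is the
parity condition on `l₁`. The step leaving `a` is then due to be an `r`-step, and it is one
automatically. -/
theorem altDefects_append_cons_eq_zero (a : α) (l₂ : List α) :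
    ∀ (r : α → α → Prop) (l₁ : List α), (∀ x ∈ l₁ ++ l₂, r a x ∧ ¬ r x a) →
    (altDefects r (l₁ ++ a :: l₂) = 0 ↔
      Even l₁.length ∧ altDefects r l₁ = 0 ∧ altDefects (flip r) l₂ = 0)
  | r, [], h => by
    rw [List.nil_append, altDefects_cons_eq_zero]
    have : ∀ y ∈ l₂.head?, r a y := fun y hy => (h y (by simpa using List.mem_of_mem_head? hy)).1
    simp only [List.length_nil, Even.zero, altDefects, true_and]
    tauto
  | r, [x], h => by
    have := (h x (by simp)).2
    simp [altDefects_cons_eq_zero, this]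
  | r, x :: y :: l, h => by
    have ih := altDefects_append_cons_eq_zero a l₂ r l fun z hz => h z (by simp at hz ⊢; tauto)
    have h1 : (∀ z ∈ (l ++ a :: l₂).head?, flip r y z) ↔ ∀ z ∈ l.head?, flip r y z := by
      cases l with
      | nil => simpa [flip] using (h y (by simp)).1
      | cons z l => simp
    have hf : flip (flip r) = r := rfl
    simp only [List.cons_append, altDefects_cons_eq_zero, hf, ih, List.length_cons,
      List.head?_cons, Option.mem_def]
    have : Even (l.length + 1 + 1) ↔ Even l.length := by
      rw [Nat.even_add_one, Nat.even_add_one, not_not]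
    tauto

open Classical in
/-- The number of ways to cut a word into `m` consecutive, possibly empty, alternating blocks. -/
noncomputable def cuts : ℕ → (α → α → Prop) → List α → ℕ
  | 0, _, l => if l = [] then 1 else 0
  | m + 1, r, l => ∑ k ∈ Finset.range (l.length + 1),
      if altDefects r (l.take k) = 0 then cuts m (flip^[k] r) (l.drop k) else 0

theorem cuts_nil (m : ℕ) (r : α → α → Prop) : cuts m r [] = 1 := by
  induction m generalizing r with
  | zero => simp [cuts]
  | succ m ih => simp [cuts, ih, altDefects]

/-- Either the first block is empty, or `x` can be deleted from it without affecting whether it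
alternates. -/
theorem cuts_succ_cons_of_step (m : ℕ) (r : α → α → Prop) (x : α) (l : List α)
    (h : ∀ y ∈ l.head?, r x y) :
    cuts (m + 1) r (x :: l) = cuts m r (x :: l) + cuts (m + 1) (flip r) l := by
  have e : cuts m r (x :: l) = if altDefects r ((x :: l).take 0) = 0 then
      cuts m (flip^[0] r) ((x :: l).drop 0) else 0 := by simp [altDefects]
  rw [cuts, List.length_cons, Finset.sum_range_succ', add_comm, e]
  congr 1
  · rw [cuts]
    refine Finset.sum_congr rfl fun k _ => ?_
    have h' : ∀ y ∈ (l.take k).head?, r x y := by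
      cases l <;> cases k <;> simp_all
    have e' : altDefects r (x :: l.take k) = 0 ↔ altDefects (flip r) (l.take k) = 0 := by
      rw [altDefects_cons_eq_zero]
      exact and_iff_right h'
    simp only [List.take_succ_cons, List.drop_succ_cons, Function.iterate_succ_apply, e']

/-- A cut is forced after `x`: a nonempty first block must be `[x]`. -/
theorem cuts_succ_cons_of_not_step (m : ℕ) (r : α → α → Prop) (x : α) (l : List α)
    (h : ¬ ∀ y ∈ l.head?, r x y) :
    cuts (m + 1) r (x :: l) = cuts m r (x :: l) + cuts m (flip r) l := by
  have e : cuts m r (x :: l) = if altDefects r ((x :: l).take 0) = 0 then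
      cuts m (flip^[0] r) ((x :: l).drop 0) else 0 := by simp [altDefects]
  rw [cuts, List.length_cons, Finset.sum_range_succ', add_comm, e]
  congr 1
  · rw [Finset.sum_range_succ', Finset.sum_eq_zero, zero_add]
    · simp [altDefects]
    · intro k _
      cases l <;> simp_all [altDefects_cons_eq_zero]

-- The two recursions for `cuts` are first differences in `m`: each letter uses up one factor `1 -
-- X`, and each defect contributes an `X`. The empty word is excluded because it gives `1 / (1 -
-- X)`, without the numerator `X`.
open PowerSeries in
theorem one_sub_X_pow_mul_mk_cuts (l : List α) (hl : l ≠ []) (r : α → α → Prop) :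
    (1 - X : PowerSeries ℚ) ^ (l.length + 1) * mk (fun m => (cuts m r l : ℚ)) =
      X ^ (altDefects r l + 1) := by
  induction l generalizing r with
  | nil => exact absurd rfl hl
  | cons x l ih =>
    have hnil : (1 - X : PowerSeries ℚ) * mk (fun m => (cuts m (flip r) ([] : List α) : ℚ)) = 1 := by
      simp only [cuts_nil, Nat.cast_one]
      rw [mul_comm]
      exact mk_one_mul_one_sub_eq_one ℚ
    rw [List.length_cons, pow_succ, mul_assoc]
    by_cases h : ∀ y ∈ l.head?, r x y
    -- The recursion says nothing about the coefficient at 0, hence the correction. It is nonzero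
    -- only for `l = []`, where it produces the extra factor `X`.
    · have e : (1 - X : PowerSeries ℚ) * mk (fun m => (cuts m r (x :: l) : ℚ)) =
          mk (fun m => (cuts m (flip r) l : ℚ)) - C (cuts 0 (flip r) l : ℚ) := by
        rw [sub_mul, one_mul]
        ext m
        cases m with
        | zero => simp [cuts]
        | succ m =>
          generalize (cuts 0 (flip r) l : ℚ) = c
          simp [coeff_succ_X_mul, cuts_succ_cons_of_step m r x l h]
      rw [e]
      by_cases h0 : l = []
      · subst h0
        have : C (cuts 0 (flip r) ([] : List α) : ℚ) = 1 := by simp [cuts]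
        rw [this]
        simp only [List.length_nil, zero_add, pow_one, mul_sub, hnil, altDefects]
        simp
      · have : C (cuts 0 (flip r) l : ℚ) = 0 := by simp [cuts, h0]
        rw [this, sub_zero, ih h0, altDefects, if_pos h, zero_add]
    · have e : (1 - X : PowerSeries ℚ) * mk (fun m => (cuts m r (x :: l) : ℚ)) =
          X * mk (fun m => (cuts m (flip r) l : ℚ)) := by
        rw [sub_mul, one_mul]
        ext m
        cases m with
        | zero => simp [cuts]
        | succ m => simp [coeff_succ_X_mul, cuts_succ_cons_of_not_step m r x l h]
      have h0 : l ≠ [] := by rintro rfl; simp at h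
      rw [e, mul_left_comm, ih h0, altDefects, if_neg h]
      ring

end Lists

/-! ### Arrangements of a finite set and their decompositions. -/

section Arrangements

variable {α : Type} [DecidableEq α]

/-- The words in which each element of `S` occurs exactly once, and no other letter occurs. -/
def arrangements (S : Finset α) : Finset (List α) := S.val.lists.toFinset

theorem mem_arrangements {S : Finset α} {l : List α} :
    l ∈ arrangements S ↔ l.Nodup ∧ l.toFinset = S := by
  rw [arrangements, Multiset.mem_toFinset, Multiset.mem_lists_iff]
  constructor
  · intro h
    have hl : l.Nodup := by
      have := S.nodup
      rwa [h] at this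
    refine ⟨hl, ?_⟩
    ext x
    rw [List.mem_toFinset, ← Finset.mem_val, h]
    simp
  · rintro ⟨h, rfl⟩
    rw [List.toFinset_val, h.dedup]
    rfl

theorem length_of_mem_arrangements {S : Finset α} {l : List α} (h : l ∈ arrangements S) :
    l.length = S.card := by
  obtain ⟨n, rfl⟩ := mem_arrangements.1 h
  exact (List.toFinset_card_of_nodup n).symm

theorem append_mem_arrangements {S T : Finset α} (hT : T ⊆ S) {l₁ l₂ : List α}
    (h₁ : l₁ ∈ arrangements T) (h₂ : l₂ ∈ arrangements (S \ T)) : l₁ ++ l₂ ∈ arrangements S := by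
  obtain ⟨n₁, rfl⟩ := mem_arrangements.1 h₁
  obtain ⟨n₂, e₂⟩ := mem_arrangements.1 h₂
  rw [mem_arrangements, List.toFinset_append, e₂, Finset.union_sdiff_of_subset hT]
  refine ⟨n₁.append n₂ fun x hx hx' => ?_, rfl⟩
  rw [← List.mem_toFinset, e₂] at hx'
  simp_all

theorem mem_arrangements_sdiff_of_append {S : Finset α} {l₁ l₂ : List α}
    (h : l₁ ++ l₂ ∈ arrangements S) :
    l₁.toFinset ⊆ S ∧ l₁ ∈ arrangements l₁.toFinset ∧ l₂ ∈ arrangements (S \ l₁.toFinset) := by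
  obtain ⟨n, rfl⟩ := mem_arrangements.1 h
  rw [List.nodup_append'] at n
  refine ⟨by simp, mem_arrangements.2 ⟨n.1, rfl⟩, mem_arrangements.2 ⟨n.2.1, ?_⟩⟩
  rw [List.toFinset_append, Finset.union_sdiff_left, eq_comm, Finset.sdiff_eq_self_iff_disjoint]
  rw [Finset.disjoint_left]
  intro x hx hx'
  exact n.2.2 (by simpa using hx') (by simpa using hx)

/-- `T` is the set of letters before the cut; this is the source of the binomial convolution. -/
theorem sum_arrangements_split {M : Type*} [AddCommMonoid M] (S : Finset α)
    (f : List α → List α → M) :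
    ∑ l ∈ arrangements S, ∑ k ∈ Finset.range (l.length + 1), f (l.take k) (l.drop k) =
      ∑ T ∈ S.powerset, ∑ l₁ ∈ arrangements T, ∑ l₂ ∈ arrangements (S \ T), f l₁ l₂ := by
  simp only [Finset.sum_sigma']
  symm
  refine Finset.sum_bij (fun x _ => ⟨x.2.1 ++ x.2.2, x.2.1.length⟩) ?_ ?_ ?_ ?_
  · rintro ⟨T, l₁, l₂⟩ h
    simp only [Finset.mem_sigma, Finset.mem_powerset, Finset.mem_range] at h ⊢
    exact ⟨append_mem_arrangements h.1 h.2.1 h.2.2, by simp⟩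
  · rintro ⟨T, l₁, l₂⟩ h ⟨T', l₁', l₂'⟩ h' e
    simp only [Finset.mem_sigma, Finset.mem_powerset] at h h'
    simp only [Sigma.mk.injEq, heq_eq_eq] at e
    obtain ⟨rfl, rfl⟩ := List.append_inj e.1 e.2
    have := (mem_arrangements.1 h.2.1).2.symm.trans (mem_arrangements.1 h'.2.1).2
    subst this
    rfl
  · rintro ⟨l, k⟩ h
    simp only [Finset.mem_sigma, Finset.mem_range] at h
    have h1 : l.take k ++ l.drop k ∈ arrangements S := by rw [List.take_append_drop]; exact h.1
    refine ⟨⟨(l.take k).toFinset, l.take k, l.drop k⟩, ?_, ?_⟩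
    · simp only [Finset.mem_sigma, Finset.mem_powerset]
      exact mem_arrangements_sdiff_of_append h1
    · have : min k l.length = k := by omega
      simp [this]
  · rintro ⟨T, l₁, l₂⟩ h
    simp

theorem sum_arrangements_insert {M : Type*} [AddCommMonoid M] {S : Finset α} {a : α}
    (ha : a ∉ S) (f : List α → M) :
    ∑ l ∈ arrangements (insert a S), f l =
      ∑ T ∈ S.powerset, ∑ l₁ ∈ arrangements T, ∑ l₂ ∈ arrangements (S \ T),
        f (l₁ ++ a :: l₂) := by
  simp only [Finset.sum_sigma']
  symm
  refine Finset.sum_bij (fun x _ => x.2.1 ++ a :: x.2.2) ?_ ?_ ?_ ?_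
  · rintro ⟨T, l₁, l₂⟩ h
    simp only [Finset.mem_sigma, Finset.mem_powerset] at h ⊢
    have h1 := mem_arrangements.1 (append_mem_arrangements h.1 h.2.1 h.2.2)
    have hp : (l₁ ++ a :: l₂).Perm (a :: (l₁ ++ l₂)) := List.perm_middle
    rw [mem_arrangements, hp.nodup_iff, List.toFinset_eq_of_perm _ _ hp, List.toFinset_cons, h1.2,
      List.nodup_cons, ← List.mem_toFinset, h1.2]
    exact ⟨⟨ha, h1.1⟩, rfl⟩
  · rintro ⟨T, l₁, l₂⟩ h ⟨T', l₁', l₂'⟩ h' e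
    simp only [Finset.mem_sigma, Finset.mem_powerset] at h h'
    have key : ∀ {T : Finset α} {l₁ : List α}, T ⊆ S → l₁ ∈ arrangements T → a ∉ l₁ := by
      intro T l₁ hT hl hal
      rw [← List.mem_toFinset, (mem_arrangements.1 hl).2] at hal
      exact ha (hT hal)
    have key2 : ∀ {T : Finset α} {l₁ : List α}, l₁ ∈ arrangements (S \ T) → a ∉ l₁ :=
      fun h => key Finset.sdiff_subset h
    obtain ⟨rfl, rfl⟩ : l₁ = l₁' ∧ l₂ = l₂' := by
      have := (List.append_cons_inj_of_notMem (key h.1 h.2.1) (key2 h.2.2)).1 e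
      tauto
    have := (mem_arrangements.1 h.2.1).2.symm.trans (mem_arrangements.1 h'.2.1).2
    subst this
    rfl
  · intro l h
    have hm := mem_arrangements.1 h
    have hal : a ∈ l := by rw [← List.mem_toFinset, hm.2]; simp
    obtain ⟨l₁, l₂, rfl⟩ := List.append_of_mem hal
    have hp : (l₁ ++ a :: l₂).Perm (a :: (l₁ ++ l₂)) := List.perm_middle
    rw [hp.nodup_iff, List.toFinset_eq_of_perm _ _ hp, List.toFinset_cons, List.nodup_cons] at hm
    have h1 : l₁ ++ l₂ ∈ arrangements S := by
      refine mem_arrangements.2 ⟨hm.1.2, ?_⟩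
      have : (insert a (l₁ ++ l₂).toFinset).erase a = (insert a S).erase a := by rw [hm.2]
      rwa [Finset.erase_insert ha, Finset.erase_insert (by simpa using hm.1.1)] at this
    refine ⟨⟨l₁.toFinset, l₁, l₂⟩, ?_, rfl⟩
    simp only [Finset.mem_sigma, Finset.mem_powerset]
    exact mem_arrangements_sdiff_of_append h1
  · rintro ⟨T, l₁, l₂⟩ h
    rfl

end Arrangements

/-! ### Permutations as words. -/

section Words

theorem sum_perm_ofFn {M : Type*} [AddCommMonoid M] (n : ℕ) (f : List (Fin n) → M) :
    ∑ σ : Equiv.Perm (Fin n), f (List.ofFn σ) = ∑ l ∈ arrangements Finset.univ, f l := by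
  refine Finset.sum_bij (fun σ _ => List.ofFn σ) ?_ ?_ ?_ ?_
  · intro σ _
    rw [mem_arrangements]
    refine ⟨List.nodup_ofFn.2 σ.injective, ?_⟩
    ext x
    simpa [List.mem_ofFn] using σ.surjective x
  · intro σ _ τ _ h
    exact DFunLike.coe_injective (List.ofFn_injective h)
  · intro l hl
    have hlen : l.length = n := by simpa using length_of_mem_arrangements hl
    have hn := (mem_arrangements.1 hl).1
    have hinj : Function.Injective fun i : Fin n => l.get (i.cast hlen.symm) := fun i j h => by
      simpa using hn.injective_get h
    refine ⟨Equiv.ofBijective _ (Finite.injective_iff_bijective.1 hinj), Finset.mem_univ _, ?_⟩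
    refine List.ext_get (by simp [hlen]) ?_
    intro i h1 h2
    simp
  · intro σ _
    rfl

open Classical in
theorem altDefects_eq_card {α : Type} (l : List α) (r : α → α → Prop) :
    altDefects r l = ((Finset.range (l.length - 1)).filter fun i =>
      ∃ h : i + 1 < l.length, if Even i then ¬ r l[i] l[i + 1] else ¬ r l[i + 1] l[i]).card := by
  induction l generalizing r with
  | nil => simp [altDefects]
  | cons x l ih =>
    cases l with
    | nil => simp [altDefects]
    | cons y l =>
      rw [altDefects, ih]
      simp only [List.length_cons, Nat.add_sub_cancel]
      rw [Finset.card_filter, Finset.card_filter, Finset.sum_range_succ', add_comm]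
      congr 1
      · refine Finset.sum_congr rfl fun i _ => ?_
        by_cases hi : Even i <;> simp [hi, Nat.even_add_one, flip]
      · simp

theorem altDes_eq_altDefects {n : ℕ} (σ : Equiv.Perm (Fin n)) :
    altDes σ = altDefects (· < ·) (List.ofFn σ) := by
  classical
  rw [altDes, altDescentSet, altDefects_eq_card]
  symm
  -- List indices start at 0 and positions at 1, so even indices correspond to odd positions.
  refine Finset.card_bij (fun i _ => i + 1) ?_ ?_ ?_
  · intro i hi
    simp only [Finset.mem_filter, Finset.mem_range, List.length_ofFn, Finset.mem_Ico,
      List.getElem_ofFn] at hi ⊢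
    obtain ⟨h1, h2, h3⟩ := hi
    refine ⟨by omega, by omega, by omega, ?_⟩
    have hne : σ ⟨i, by omega⟩ ≠ σ ⟨i + 1, h2⟩ := fun h => by
      simpa using σ.injective h
    simp only [entry, Nat.add_sub_cancel, Nat.odd_add_one, Nat.even_add_one, Nat.not_odd_iff_even]
    split_ifs at h3 with he
    · exact Or.inl ⟨he, lt_of_le_of_ne (not_lt.1 h3) hne.symm⟩
    · exact Or.inr ⟨he, lt_of_le_of_ne (not_lt.1 h3) hne⟩
  · intro i _ j _ h
    omega
  · intro i hi
    simp only [Finset.mem_filter, Finset.mem_Ico] at hi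
    obtain ⟨⟨h1, h2⟩, _, _, h3⟩ := hi
    obtain ⟨i, rfl⟩ : ∃ j, i = j + 1 := ⟨i - 1, by omega⟩
    refine ⟨i, ?_, rfl⟩
    simp only [Finset.mem_filter, Finset.mem_range, List.length_ofFn, List.getElem_ofFn]
    refine ⟨by omega, h2, ?_⟩
    simp only [entry, Nat.add_sub_cancel, Nat.odd_add_one, Nat.even_add_one,
      Nat.not_odd_iff_even] at h3
    split_ifs with he
    · have := h3.resolve_right (by tauto)
      exact not_lt.2 this.2.le
    · have := h3.resolve_left (by tauto)
      exact not_lt.2 this.2.le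

theorem isUpDown_iff_altDes_eq_zero {n : ℕ} (σ : Equiv.Perm (Fin n)) :
    IsUpDown σ ↔ altDes σ = 0 := by
  rw [altDes, Finset.card_eq_zero, altDescentSet, Finset.filter_eq_empty_iff]
  constructor
  · rintro h i hi ⟨h1, hn, h2⟩
    rcases h2 with ⟨ho, h2⟩ | ⟨he, h2⟩
    · exact lt_asymm h2 ((h i hn h1).1 ho)
    · exact lt_asymm h2 ((h i hn h1).2 he)
  · intro h i hn h1
    have h0 := h (Finset.mem_Ico.2 ⟨h1, hn⟩)
    have hne : entry σ i h1 (by omega) ≠ entry σ (i + 1) (by omega) (by omega) := fun h => by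
      have := σ.injective h
      simp only [Fin.mk.injEq] at this
      omega
    refine ⟨fun ho => ?_, fun he => ?_⟩
    · by_contra h2
      exact h0 ⟨h1, hn, Or.inl ⟨ho, lt_of_le_of_ne (not_lt.1 h2) hne.symm⟩⟩
    · by_contra h2
      exact h0 ⟨h1, hn, Or.inr ⟨he, lt_of_le_of_ne (not_lt.1 h2) hne⟩⟩

end Words

/-! ### Alternating arrangements and the Euler recurrence. -/

section Counting

variable {α : Type}

/-- The number of alternating arrangements of `S`, starting with an `r`-step. -/
noncomputable def altCount [DecidableEq α] (r : α → α → Prop) (S : Finset α) : ℕ :=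
  ∑ l ∈ arrangements S, if altDefects r l = 0 then 1 else 0

theorem eulerNumber_eq_altCount (n : ℕ) :
    eulerNumber n = altCount (· < ·) (Finset.univ : Finset (Fin n)) := by
  rw [eulerNumber, altCount, ← sum_perm_ofFn, Finset.card_filter]
  refine Finset.sum_congr rfl fun σ _ => ?_
  simp only [isUpDown_iff_altDes_eq_zero, altDes_eq_altDefects]

theorem arrangements_empty [DecidableEq α] : arrangements (∅ : Finset α) = {[]} := by
  ext l
  rw [mem_arrangements]
  constructor
  · rintro ⟨_, h⟩
    simpa using h
  · intro h
    simp_all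

theorem altCount_empty [DecidableEq α] (r : α → α → Prop) : altCount r (∅ : Finset α) = 1 := by
  rw [altCount, arrangements_empty, Finset.sum_singleton]
  simp [altDefects]

theorem altCount_insert [DecidableEq α] (r : α → α → Prop) {S : Finset α} {a : α} (ha : a ∉ S)
    (h : ∀ x ∈ S, r a x ∧ ¬ r x a) :
    altCount r (insert a S) = ∑ T ∈ S.powerset,
      if Even T.card then altCount r T * altCount (flip r) (S \ T) else 0 := by
  rw [altCount, sum_arrangements_insert ha]
  refine Finset.sum_congr rfl fun T hT => ?_
  rw [Finset.mem_powerset] at hT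
  have key : ∀ l₁ ∈ arrangements T, ∀ l₂ ∈ arrangements (S \ T),
      (if altDefects r (l₁ ++ a :: l₂) = 0 then 1 else 0) = if Even T.card then
        (if altDefects r l₁ = 0 then 1 else 0) * (if altDefects (flip r) l₂ = 0 then 1 else 0)
        else 0 := by
    intro l₁ h₁ l₂ h₂
    have := altDefects_append_cons_eq_zero a l₂ r l₁ fun x hx => h x <| by
      rwa [← (mem_arrangements.1 (append_mem_arrangements hT h₁ h₂)).2, List.mem_toFinset]
    rw [length_of_mem_arrangements h₁] at this
    simp only [this]
    by_cases h1 : Even T.card <;> by_cases h2 : altDefects r l₁ = 0 <;>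
      by_cases h3 : altDefects (flip r) l₂ = 0 <;> simp [h1, h2, h3]
  rw [Finset.sum_congr rfl fun l₁ h₁ => Finset.sum_congr rfl fun l₂ h₂ => key l₁ h₁ l₂ h₂]
  split_ifs with h1
  · rw [altCount, altCount, Finset.sum_mul_sum]
  · simp

/-- Removing the minimum for `<` and the maximum for `>` gives the same recurrence. The direction
flips after the removed letter, so the two counts need a joint induction. -/
theorem altCount_eq_eulerNumber (n : ℕ) : ∀ {α : Type} [LinearOrder α] (S : Finset α),
    S.card = n → altCount (· < ·) S = eulerNumber n ∧ altCount (· > ·) S = eulerNumber n := by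
  induction n using Nat.strong_induction_on with
  | _ n ih =>
  have main : ∀ {α : Type} [LinearOrder α] (S : Finset α), S.card = n →
      altCount (· < ·) S = (if n = 0 then 1 else ∑ k ∈ Finset.range (n - 1 + 1),
        (n - 1).choose k • (if Even k then eulerNumber k * eulerNumber (n - 1 - k) else 0)) ∧
      altCount (· > ·) S = (if n = 0 then 1 else ∑ k ∈ Finset.range (n - 1 + 1),
        (n - 1).choose k • (if Even k then eulerNumber k * eulerNumber (n - 1 - k) else 0)) := by
    intro α _ S hS
    split_ifs with h0
    · subst h0
      rw [Finset.card_eq_zero] at hS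
      subst hS
      exact ⟨altCount_empty _, altCount_empty _⟩
    · have hne : S.Nonempty := by rw [← Finset.card_pos]; omega
      have aux : ∀ a ∈ S, ∀ T ∈ (S.erase a).powerset,
          T.card < n ∧ (S.erase a \ T).card = n - 1 - T.card ∧ n - 1 - T.card < n := by
        intro a ha T hT
        rw [Finset.mem_powerset] at hT
        have h1 := Finset.card_le_card hT
        have h2 := Finset.card_erase_of_mem ha
        rw [Finset.card_sdiff_of_subset hT]
        omega
      have hcard : ∀ a ∈ S, (S.erase a).card = n - 1 := fun a ha => by
        rw [Finset.card_erase_of_mem ha, hS]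
      constructor
      · have ha := S.min'_mem hne
        have e := altCount_insert (· < ·) (Finset.notMem_erase (S.min' hne) S) fun x hx => by
          have := S.min'_lt_of_mem_erase_min' hne hx
          exact ⟨this, this.not_gt⟩
        rw [Finset.insert_erase ha] at e
        rw [e, ← hcard _ ha, ← Finset.sum_powerset_apply_card
          (fun k => if Even k then eulerNumber k * eulerNumber ((S.erase (S.min' hne)).card - k)
            else 0)]
        refine Finset.sum_congr rfl fun T hT => ?_
        obtain ⟨h1, h2, h3⟩ := aux _ ha T hT
        rw [(ih _ h1 T rfl).1, hcard _ ha]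
        split_ifs
        · exact congrArg _ (ih _ h3 _ h2).2
        · rfl
      · have ha := S.max'_mem hne
        have e := altCount_insert (· > ·) (Finset.notMem_erase (S.max' hne) S) fun x hx => by
          have := S.lt_max'_of_mem_erase_max' hne hx
          exact ⟨this, this.not_gt⟩
        rw [Finset.insert_erase ha] at e
        rw [e, ← hcard _ ha, ← Finset.sum_powerset_apply_card
          (fun k => if Even k then eulerNumber k * eulerNumber ((S.erase (S.max' hne)).card - k)
            else 0)]
        refine Finset.sum_congr rfl fun T hT => ?_
        obtain ⟨h1, h2, h3⟩ := aux _ ha T hT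
        rw [(ih _ h1 T rfl).2, hcard _ ha]
        split_ifs
        · exact congrArg _ (ih _ h3 _ h2).1
        · rfl
  intro α _ S hS
  rw [(main S hS).1, (main S hS).2, eulerNumber_eq_altCount, (main Finset.univ (by simp)).1]
  exact ⟨rfl, rfl⟩

theorem eulerNumber_zero : eulerNumber 0 = 1 := by
  rw [eulerNumber_eq_altCount, Finset.univ_eq_empty, altCount_empty]

theorem eulerNumber_succ (n : ℕ) :
    eulerNumber (n + 1) = ∑ k ∈ Finset.range (n + 1),
      n.choose k • (if Even k then eulerNumber k * eulerNumber (n - k) else 0) := by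
  have e := altCount_insert (· < ·) (S := Finset.range (n + 1) \ {0}) (a := 0) (by simp)
    fun x hx => by
      simp only [Finset.mem_sdiff, Finset.mem_singleton] at hx
      omega
  have hc : (Finset.range (n + 1) \ {0}).card = n := by
    rw [Finset.card_sdiff_of_subset (by simp)]
    simp
  have hi : insert 0 (Finset.range (n + 1) \ {0}) = Finset.range (n + 1) := by
    ext x
    simp only [Finset.mem_insert, Finset.mem_sdiff, Finset.mem_range, Finset.mem_singleton]
    omega
  rw [hi, (altCount_eq_eulerNumber (n + 1) _ (by simp)).1] at e
  conv_rhs => rw [← hc]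
  rw [e, ← Finset.sum_powerset_apply_card
    (fun k => if Even k then eulerNumber k *
      eulerNumber ((Finset.range (n + 1) \ {0}).card - k) else 0)]
  refine Finset.sum_congr rfl fun T hT => ?_
  rw [Finset.mem_powerset] at hT
  rw [(altCount_eq_eulerNumber _ T rfl).1]
  split_ifs
  · exact congrArg _ (altCount_eq_eulerNumber _ _ (Finset.card_sdiff_of_subset hT)).2
  · rfl

end Counting

/-! ### The exponential formula as a recurrence over partitions. -/

section Partitions

variable (b : ℕ → ℚ)

/-- The weight `∏ b_i ^ r_i / r_i!` of a multiset with `r_i` parts equal to `i`. -/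
noncomputable def partsWeight (s : Multiset ℕ) : ℚ :=
  ∏ i ∈ s.toFinset, b i ^ s.count i / ((s.count i)! : ℚ)

theorem partsWeight_eq_prod {s : Multiset ℕ} {U : Finset ℕ} (h : s.toFinset ⊆ U) :
    partsWeight b s = ∏ i ∈ U, b i ^ s.count i / ((s.count i)! : ℚ) := by
  refine Finset.prod_subset h fun i _ hi => ?_
  rw [Multiset.mem_toFinset] at hi
  simp [Multiset.count_eq_zero_of_notMem hi]

theorem count_mul_partsWeight_cons (a : ℕ) (s : Multiset ℕ) :
    ((a ::ₘ s).count a : ℚ) * partsWeight b (a ::ₘ s) = b a * partsWeight b s := by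
  have ha : a ∈ (a ::ₘ s).toFinset := by simp
  rw [partsWeight_eq_prod b (s := s) (U := (a ::ₘ s).toFinset) (by simp), partsWeight,
    ← Finset.mul_prod_erase _ _ ha, ← Finset.mul_prod_erase _ _ ha, ← mul_assoc, ← mul_assoc]
  congr 1
  · rw [Multiset.count_cons_self, Nat.factorial_succ, pow_succ]
    have : ((s.count a)! : ℚ) ≠ 0 := by positivity
    push_cast
    field_simp
  · refine Finset.prod_congr rfl fun i hi => ?_
    rw [Multiset.count_cons_of_ne (Finset.ne_of_mem_erase hi)]

/-- The sum of the weights of all partitions of `n`. -/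
noncomputable def partitionSum (n : ℕ) : ℚ := ∑ p : n.Partition, partsWeight b p.parts

theorem partitionSum_zero : partitionSum b 0 = 1 := by
  rw [partitionSum, Fintype.sum_unique]
  simp [partsWeight]

/-- Write the size of a partition as `∑ i * r_i` over its distinct parts, then strike out one copy
of the part `i`: `count_mul_partsWeight_cons` turns `r_i` into `b i`. -/
theorem succ_mul_partitionSum_succ (n : ℕ) :
    ((n : ℚ) + 1) * partitionSum b (n + 1) =
      ∑ x ∈ Finset.HasAntidiagonal.antidiagonal n, ((x.1 : ℚ) + 1) * b (x.1 + 1) * partitionSum b x.2 := by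
  have h : ∀ p : (n + 1).Partition, ((n : ℚ) + 1) * partsWeight b p.parts =
      ∑ i ∈ p.parts.toFinset, (i : ℚ) * ((p.parts.count i : ℚ) * partsWeight b p.parts) := by
    intro p
    have e : ((n : ℚ) + 1) = ∑ i ∈ p.parts.toFinset, (i : ℚ) * (p.parts.count i : ℚ) := by
      have h1 := Finset.sum_multiset_count p.parts
      rw [p.parts_sum] at h1
      have h2 := congrArg (Nat.cast : ℕ → ℚ) h1
      push_cast at h2
      rw [h2]
      refine Finset.sum_congr rfl fun i _ => ?_
      simp [mul_comm]
    rw [e, Finset.sum_mul]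
    exact Finset.sum_congr rfl fun i _ => mul_assoc _ _ _
  simp only [partitionSum, Finset.mul_sum, h]
  rw [Finset.sum_sigma', Finset.sum_sigma']
  symm
  refine Finset.sum_bij (fun x hx => ⟨⟨(x.1.1 + 1) ::ₘ x.2.parts, ?_, ?_⟩, x.1.1 + 1⟩) ?_ ?_ ?_ ?_
  · intro i hi
    rw [Multiset.mem_cons] at hi
    rcases hi with rfl | hi
    · omega
    · exact x.2.parts_pos hi
  · have := (Finset.mem_sigma.1 hx).1
    rw [Finset.HasAntidiagonal.mem_antidiagonal] at this
    rw [Multiset.sum_cons, x.2.parts_sum]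
    omega
  · rintro ⟨⟨i, j⟩, q⟩ hx
    simp
  · rintro ⟨⟨i, j⟩, q⟩ hx ⟨⟨i', j'⟩, q'⟩ hx' e
    simp only [Sigma.mk.injEq, Nat.Partition.mk.injEq, heq_eq_eq, Nat.add_right_cancel_iff] at e
    obtain ⟨e1, rfl⟩ := e
    simp only [Multiset.cons_inj_right] at e1
    simp only [Finset.mem_sigma, Finset.HasAntidiagonal.mem_antidiagonal] at hx hx'
    obtain rfl : j = j' := by omega
    obtain rfl : q = q' := Nat.Partition.ext e1
    rfl
  · rintro ⟨p, i⟩ hx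
    simp only [Finset.mem_sigma, Multiset.mem_toFinset] at hx
    have hi := p.parts_pos hx.2
    have hc := Multiset.cons_erase hx.2
    have hs : i + (p.parts.erase i).sum = n + 1 := by
      rw [← Multiset.sum_cons, hc, p.parts_sum]
    refine ⟨⟨(i - 1, n - (i - 1)), ⟨p.parts.erase i,
      fun hj => p.parts_pos (Multiset.mem_of_mem_erase hj), by omega⟩⟩, ?_, ?_⟩
    · simp only [Finset.mem_sigma, Finset.HasAntidiagonal.mem_antidiagonal, Finset.mem_univ, and_true]
      omega
    · have : i - 1 + 1 = i := by omega
      simp only [this, hc]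
  · rintro ⟨⟨i, j⟩, q⟩ hx
    simp only [count_mul_partsWeight_cons]
    push_cast
    ring

/-- Grouping equal parts, the `i ^ r_i` in `zee` supplies the division by `i`, and `r_i !` is the
one in `partsWeight`. Partitions with an even part get weight 0. -/
theorem eval_fHat (n : ℕ) (m : ℚ) :
    (fHat n).eval m = n ! * partitionSum
      (fun i => if Odd i then m * ((eulerNumber (i - 1) : ℚ) / ((i - 1)! : ℚ)) / i else 0) n := by
  rw [fHat, Polynomial.eval_finsetSum, partitionSum, Finset.mul_sum]
  rw [← Finset.sum_subset (Finset.subset_univ (Nat.Partition.odds n))]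
  · refine Finset.sum_congr rfl fun p hp => ?_
    have hodd : ∀ i ∈ p.parts, Odd i := by
      simpa [Nat.Partition.odds, Nat.Partition.restricted] using hp
    simp only [Polynomial.eval_mul, Polynomial.eval_C, Polynomial.eval_pow, Polynomial.eval_X]
    rw [div_eq_mul_inv, mul_assoc, mul_assoc]
    congr 1
    rw [Finset.prod_multiset_map_count, zee, partsWeight, ← Multiset.toFinset_sum_count_eq,
      ← Finset.prod_pow_eq_pow_sum, ← Finset.prod_mul_distrib]
    push_cast
    rw [← Finset.prod_inv_distrib, ← Finset.prod_mul_distrib]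
    refine Finset.prod_congr rfl fun i hi => ?_
    have hi' := hodd i (Multiset.mem_toFinset.1 hi)
    have h0 : (i : ℚ) ≠ 0 := by exact_mod_cast hi'.pos.ne'
    rw [if_pos hi', div_pow, div_pow, mul_pow, div_pow]
    have : ((p.parts.count i)! : ℚ) ≠ 0 := by positivity
    field_simp
  · intro p _ hp
    have : ∃ i ∈ p.parts, ¬ Odd i := by
      simpa [Nat.Partition.odds, Nat.Partition.restricted] using hp
    obtain ⟨i, hi, hi'⟩ := this
    rw [partsWeight, Finset.prod_eq_zero (Multiset.mem_toFinset.2 hi), mul_zero]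
    have := Multiset.count_pos.2 hi
    simp [hi', this.ne']

end Partitions

/-! ### Powers of the Euler generating function. -/

section GeneratingFunctions

open PowerSeries

/-- The exponential generating function of the Euler numbers. -/
noncomputable def eulerSeries : PowerSeries ℚ := mk fun n => (eulerNumber n : ℚ) / (n ! : ℚ)

/-- The even part of the exponential generating function of the Euler numbers. -/
noncomputable def eulerEvenSeries : PowerSeries ℚ :=
  mk fun n => if Even n then (eulerNumber n : ℚ) / (n ! : ℚ) else 0

theorem factorial_mul_coeff_mul (n : ℕ) (f g : PowerSeries ℚ) :
    (n ! : ℚ) * coeff n (f * g) = ∑ k ∈ Finset.range (n + 1),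
      n.choose k • ((k ! : ℚ) * coeff k f * (((n - k)! : ℚ) * coeff (n - k) g)) := by
  rw [coeff_mul, Finset.Nat.sum_antidiagonal_eq_sum_range_succ_mk, Finset.mul_sum]
  refine Finset.sum_congr rfl fun k hk => ?_
  rw [← Nat.choose_mul_factorial_mul_factorial (Finset.mem_range_succ_iff.1 hk), nsmul_eq_mul]
  push_cast
  ring

theorem factorial_mul_coeff_eulerSeries (n : ℕ) :
    (n ! : ℚ) * coeff n eulerSeries = eulerNumber n := by
  have : (n ! : ℚ) ≠ 0 := by positivity
  rw [eulerSeries, coeff_mk]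
  field_simp

theorem factorial_mul_coeff_eulerEvenSeries (n : ℕ) :
    (n ! : ℚ) * coeff n eulerEvenSeries = if Even n then (eulerNumber n : ℚ) else 0 := by
  have : (n ! : ℚ) ≠ 0 := by positivity
  rw [eulerEvenSeries, coeff_mk]
  split_ifs
  · field_simp
  · simp

theorem derivative_eulerSeries : d⁄dX ℚ eulerSeries = eulerEvenSeries * eulerSeries := by
  ext n
  have h : (n ! : ℚ) ≠ 0 := by positivity
  refine mul_left_cancel₀ h ?_
  rw [factorial_mul_coeff_mul, coeff_derivative]
  have : (n ! : ℚ) * (coeff (n + 1) eulerSeries * (n + 1)) =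
      ((n + 1)! : ℚ) * coeff (n + 1) eulerSeries := by
    rw [Nat.factorial_succ]
    push_cast
    ring
  rw [this, factorial_mul_coeff_eulerSeries, eulerNumber_succ, Nat.cast_sum]
  refine Finset.sum_congr rfl fun k _ => ?_
  rw [factorial_mul_coeff_eulerSeries, factorial_mul_coeff_eulerEvenSeries]
  split_ifs <;> simp

/-- Splitting off the first block multiplies by `eulerSeries`. Both orders are covered because the
pattern is reversed after a block of odd length. -/
theorem sum_cuts_eq {α : Type} [LinearOrder α] (m : ℕ) (r : α → α → Prop)
    (hr : r = (· < ·) ∨ r = (· > ·)) (S : Finset α) :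
    (∑ l ∈ arrangements S, (cuts m r l : ℚ)) = (S.card ! : ℚ) * coeff S.card (eulerSeries ^ m) := by
  induction m generalizing r S with
  | zero =>
    rw [pow_zero]
    rcases S.eq_empty_or_nonempty with rfl | hS
    · rw [arrangements_empty, Finset.sum_singleton]
      simp [cuts]
    · rw [coeff_one, if_neg hS.card_pos.ne', mul_zero]
      refine Finset.sum_eq_zero fun l hl => ?_
      have : l ≠ [] := by
        rintro rfl
        have := length_of_mem_arrangements hl
        have := hS.card_pos
        simp_all
      simp [cuts, this]
  | succ m ih =>
    have hflip : ∀ k, flip^[k] r = (· < ·) ∨ flip^[k] r = (· > ·) := by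
      intro k
      induction k with
      | zero => exact hr
      | succ k ihk =>
        rw [Function.iterate_succ_apply']
        rcases ihk with h | h
        · exact Or.inr (by rw [h]; rfl)
        · exact Or.inl (by rw [h]; rfl)
    have halt : ∀ T : Finset α, altCount r T = eulerNumber T.card := by
      intro T
      rcases hr with rfl | rfl
      · exact (altCount_eq_eulerNumber _ T rfl).1
      · exact (altCount_eq_eulerNumber _ T rfl).2
    have key : ∑ l ∈ arrangements S, (cuts (m + 1) r l : ℚ) = ∑ l ∈ arrangements S,
        ∑ k ∈ Finset.range (l.length + 1), (if altDefects r (l.take k) = 0 then 1 else 0) *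
          (cuts m (flip^[(l.take k).length] r) (l.drop k) : ℚ) := by
      refine Finset.sum_congr rfl fun l _ => ?_
      rw [cuts, Nat.cast_sum]
      refine Finset.sum_congr rfl fun k hk => ?_
      rw [List.length_take, min_eq_left (Finset.mem_range_succ_iff.1 hk)]
      split_ifs <;> simp
    rw [key, sum_arrangements_split S fun l₁ l₂ =>
      (if altDefects r l₁ = 0 then 1 else 0) * (cuts m (flip^[l₁.length] r) l₂ : ℚ),
      pow_succ', factorial_mul_coeff_mul, ← Finset.sum_powerset_apply_card
      (fun k => (k ! : ℚ) * coeff k eulerSeries *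
        (((S.card - k)! : ℚ) * coeff (S.card - k) (eulerSeries ^ m)))]
    refine Finset.sum_congr rfl fun T hT => ?_
    rw [Finset.mem_powerset] at hT
    rw [factorial_mul_coeff_eulerSeries, ← Finset.card_sdiff_of_subset hT,
      ← ih _ (hflip T.card) (S \ T), ← halt, altCount, Nat.cast_sum, Finset.sum_mul_sum]
    refine Finset.sum_congr rfl fun l₁ h₁ => ?_
    rw [length_of_mem_arrangements h₁]
    push_cast
    rfl

theorem one_sub_X_pow_mul_mk_coeff (n : ℕ) (hn : 1 ≤ n) :
    (1 - X : PowerSeries ℚ) ^ (n + 1) *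
        mk (fun m => (n ! : ℚ) * coeff n (eulerSeries ^ m)) =
      (altEulerianPoly n : PowerSeries ℚ) := by
  have h : mk (fun m => (n ! : ℚ) * coeff n (eulerSeries ^ m)) =
      ∑ σ : Equiv.Perm (Fin n), mk (fun m => (cuts m (· < ·) (List.ofFn σ) : ℚ)) := by
    ext m
    rw [map_sum]
    simp only [coeff_mk]
    rw [sum_perm_ofFn n fun l => (cuts m (· < ·) l : ℚ), sum_cuts_eq m _ (Or.inl rfl)]
    simp
  rw [h, Finset.mul_sum, altEulerianPoly, ← Polynomial.coeToPowerSeries.ringHom_apply, map_sum]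
  refine Finset.sum_congr rfl fun σ _ => ?_
  have := one_sub_X_pow_mul_mk_cuts (List.ofFn σ) (by simp; omega) (· < ·)
  rw [List.length_ofFn] at this
  rw [this, altDes_eq_altDefects]
  simp

/-- The equation `(E^m)' = m F E^m`, read coefficientwise, is the recurrence of
`succ_mul_partitionSum_succ`; both sequences start at 1. -/
theorem coeff_eulerSeries_pow_eq_partitionSum (m n : ℕ) :
    coeff n (eulerSeries ^ m) = partitionSum
      (fun i => if Odd i then (m : ℚ) * ((eulerNumber (i - 1) : ℚ) / ((i - 1)! : ℚ)) / i else 0)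
      n := by
  induction n using Nat.strong_induction_on with
  | _ n ih =>
  cases n with
  | zero =>
    rw [partitionSum_zero, coeff_zero_eq_constantCoeff, map_pow]
    have : constantCoeff eulerSeries = 1 := by
      rw [← coeff_zero_eq_constantCoeff_apply, eulerSeries, coeff_mk, eulerNumber_zero]
      simp
    rw [this, one_pow]
  | succ n =>
    have h0 : (n : ℚ) + 1 ≠ 0 := by positivity
    refine mul_left_cancel₀ h0 ?_
    rw [succ_mul_partitionSum_succ, mul_comm, ← coeff_derivative]
    have hd : d⁄dX ℚ (eulerSeries ^ m) =
        ((m : PowerSeries ℚ) * eulerEvenSeries) * eulerSeries ^ m := by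
      rw [Derivation.leibniz_pow, derivative_eulerSeries]
      cases m with
      | zero => simp
      | succ m => simp [pow_succ]; ring
    rw [hd, coeff_mul]
    refine Finset.sum_congr rfl fun x hx => ?_
    have hx' := Finset.HasAntidiagonal.mem_antidiagonal.1 hx
    rw [ih x.2 (by omega), ← nsmul_eq_mul, map_nsmul, eulerEvenSeries, coeff_mk]
    congr 1
    have h1 : (x.1 : ℚ) + 1 ≠ 0 := by positivity
    by_cases he : Even x.1
    · simp only [he, Nat.odd_add_one, Nat.not_odd_iff_even, if_true, Nat.add_sub_cancel,
        nsmul_eq_mul]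
      push_cast
      field_simp
    · simp [he, Nat.odd_add_one]

end GeneratingFunctions

end AltEulerian

/-! ### The main identity. -/

theorem theorem4p3 (n : ℕ) (hn : 1 ≤ n) :
    (AltEulerian.altEulerianPoly n : PowerSeries ℚ) *
        ((1 - PowerSeries.X : PowerSeries ℚ) ^ (n + 1))⁻¹ =
      PowerSeries.mk fun m : ℕ =>
        if 1 ≤ m then (AltEulerian.fHat n).eval (m : ℚ) else 0 := by
  have hc : PowerSeries.constantCoeff ((1 - PowerSeries.X : PowerSeries ℚ) ^ (n + 1)) ≠ 0 := by
    simp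
  rw [← AltEulerian.one_sub_X_pow_mul_mk_coeff n hn, mul_right_comm,
    PowerSeries.mul_inv_cancel _ hc, one_mul]
  ext m
  simp only [PowerSeries.coeff_mk]
  split_ifs with hm
  · rw [AltEulerian.eval_fHat, AltEulerian.coeff_eulerSeries_pow_eq_partitionSum]
  -- The zeroth power of the Euler series is 1, whose coefficient at `n ≥ 1` vanishes.
  · obtain rfl : m = 0 := by omega
    rw [pow_zero, PowerSeries.coeff_one, if_neg (by omega), mul_zero]
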